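/- Setting. Let $n\ge 1$ and $p\ge 0$ be integers, $\mathcal{X}$ a set of feasible data points, $\boldsymbol\Theta\subseteq\mathbb{R}^p$ nonempty, closed and convex, $R:\mathbb{R}^p\to\mathbb{R}$ convex, and for each $\mathbf{d}\in\mathcal{X}$ let $\ell(\cdot;\mathbf{d}):\mathbb{R}^p\to\mathbb{R}$ be convex and twice continuously differentiable. Suppose that $\operatorname{tr}(\nabla^2\ell(\boldsymbol\theta;\mathbf{d}))\le\lambda$ and $\|\nabla\ell(\boldsymbol\theta;\mathbf{d})\|_2\le\zeta$ for all $\boldsymbol\theta\in\boldsymbol\Theta$ and $\mathbf{d}\in\mathcal{X}$. In the first stage, an arbitrary deterministic weighting mechanism assigns to each dataset $\mathcal{D}=(\mathbf{d}_1,\dots,\mathbf{d}_n)\in\mathcal{X}^n$ a weight vector $\mathbf{w}(\mathcal{D})=(w_1,\dots,w_n)$ with $w_i\ge 0$ and $\sum_i w_i=n$. In the second stage, given $\gamma>0$, noise $\mathbf{b}$ with values in $\mathbb{R}^p$ is drawn from a distribution not depending on $\mathcal{D}$, and the algorithm DP-2ERM outputs $$\boldsymbol\theta^{\mathrm{priv}}(\mathcal{D},\mathbf{b})=\operatorname*{argmin}_{\boldsymbol\theta\in\boldsymbol\Theta}\;\frac1n\sum_{i=1}^n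 w_i\,\ell(\boldsymbol\theta;\mathbf{d}_i)+R(\boldsymbol\theta)+\frac{\gamma}{2}\|\boldsymbol\theta\|_2^2+\frac{\langle\mathbf{b},\boldsymbol\theta\rangle}{n}.$$ It is $(\epsilon,\delta)$-differentially private if $\mathbb{P}(\boldsymbol\theta^{\mathrm{priv}}(\mathcal{D},\mathbf{b})\in S)\le e^{\epsilon}\,\mathbb{P}(\boldsymbol\theta^{\mathrm{priv}}(\mathcal{D}',\mathbf{b})\in S)+\delta$ for all Borel $S\subseteq\mathbb{R}^p$ and all $\mathcal{D},\mathcal{D}'\in\mathcal{X}^n$ that differ in at most one data point; $\epsilon$-differential privacy is the case $\delta=0$. Corollary (Universal Differential Privacy of 2ERM via Objective Perturbation). Let $\epsilon>0$, $W_1=3n$, $W_2=\sqrt6\,(n+1)^{3/2}$ and $\gamma\ge\frac{2\lambda}{\epsilon n}W_2$ with $\gamma>0$. Then, irrespective of the weighting mechanism, the minimizer $\boldsymbol\theta^{\mathrm{priv}}(\mathcal{D},\mathbf{b})$ exists and is unique for all $\mathcal{D}$ and $\mathbf{b}$, and: (i) (Gamma noise) If $\beta>0$, $\mathbf{b}$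 has density proportional to $e^{-\beta\|\mathbf{x}\|_2}$, and $\frac1\beta\ge\frac{2\zeta}{\epsilon}W_1$, then DP-2ERM is $\epsilon$-differentially private. (ii) (Gaussian noise) Let $0<\delta\le1$, $\tilde L=\sqrt{(\sqrt p+\sqrt{\log\delta^{-1}})^2+\log\delta^{-1}}$, and suppose that the privacy budget is not excessively large, namely $\epsilon\le 10\,\tilde L^2$ (since $\tilde L^2\ge p$, this always holds if $p\ge1$ and $\epsilon\le10$). If $\sigma>0$, $\mathbf{b}\sim\mathcal{N}(\mathbf{0},\sigma^2\mathbf{I})$, and $\sigma\ge\frac{\zeta}{\epsilon}\left(\tilde L+\sqrt{\tilde L^2+\frac{\epsilon}{3n}}\right)W_1$, then DP-2ERM is $(\epsilon,\delta)$-differentially private. -/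

import Mathlib

open MeasureTheory ProbabilityTheory

namespace DPTwoStageERM

noncomputable section

/-- The parameter space `ℝ^p` with its Euclidean norm. -/
abbrev Param (p : ℕ) : Type := EuclideanSpace ℝ (Fin p)

/-- Two size-`n` datasets are neighbours if they differ in at most one data point. -/
def Neighbors {n : ℕ} {X : Type*} (D D' : Fin n → X) : Prop :=
  ∃ k : Fin n, ∀ i : Fin n, i ≠ k → D i = D' i

/-- `(ε, δ)`-differential privacy of the randomized mechanism which on the dataset `D` draws
`ω` from the distribution `P` and returns `M D ω`. -/
def IsDifferentiallyPrivate {n : ℕ} {X Ω Y : Type*} [MeasurableSpace Ω] [MeasurableSpace Y]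
    (P : Measure Ω) (M : (Fin n → X) → Ω → Y) (ε δ : ℝ) : Prop :=
  ∀ D D' : Fin n → X, Neighbors D D' → ∀ S : Set Y, MeasurableSet S →
    P {ω | M D ω ∈ S} ≤
      ENNReal.ofReal (Real.exp ε) * P {ω | M D' ω ∈ S} + ENNReal.ofReal δ

/-- The scaled simplex `n Δ^n`: nonnegative weight vectors of total sum `n`. -/
def weightSimplex (n : ℕ) : Set (Fin n → ℝ) :=
  {w | (∀ i, 0 ≤ w i) ∧ ∑ i, w i = (n : ℝ)}

/-- The Hessian matrix of `f` at `θ`. -/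
def hessian {p : ℕ} (f : Param p → ℝ) (θ : Param p) : Matrix (Fin p) (Fin p) ℝ :=
  Matrix.of fun i j =>
    iteratedFDeriv ℝ 2 f θ ![EuclideanSpace.single i (1 : ℝ), EuclideanSpace.single j (1 : ℝ)]

/-- A minimizer of `f` over `s` (the value is `0` if there is none). -/
def argminOn {p : ℕ} (s : Set (Param p)) (f : Param p → ℝ) : Param p :=
  open Classical in
  if h : ∃ θ, θ ∈ s ∧ IsMinOn f s θ then h.choose else 0

/-- The perturbed second-stage objective
`(1/n) ∑ w_i ℓ(θ; d_i) + R(θ) + (γ/2) ‖θ‖² + ⟨b, θ⟩ / n`; here `ℓ d θ` is the loss of the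
parameter `θ` at the data point `d`, and `w D` is the first-stage weight vector of `D`. -/
def privObjective {p n : ℕ} {X : Type*} (ℓ : X → Param p → ℝ) (R : Param p → ℝ)
    (w : (Fin n → X) → Fin n → ℝ) (γ : ℝ) (D : Fin n → X) (b θ : Param p) : ℝ :=
  (1 / (n : ℝ)) * ∑ i, w D i * ℓ (D i) θ + R θ + γ / 2 * ‖θ‖ ^ 2 + inner ℝ b θ / (n : ℝ)

/-- The output `θ^priv(D, b)` of the two-stage algorithm on the dataset `D` with noise `b`. -/
def privEstimator {p n : ℕ} {X : Type*} (Θ : Set (Param p)) (ℓ : X → Param p → ℝ)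
    (R : Param p → ℝ) (w : (Fin n → X) → Fin n → ℝ) (γ : ℝ) (D : Fin n → X) (b : Param p) :
    Param p :=
  argminOn Θ (privObjective ℓ R w γ D b)

/-- The measure on `ℝ^p` with density `exp (-β ‖x‖)`. -/
def gammaWeight (p : ℕ) (β : ℝ) : Measure (Param p) :=
  (volume : Measure (Param p)).withDensity fun x => ENNReal.ofReal (Real.exp (-β * ‖x‖))

/-- Gamma noise: the probability measure on `ℝ^p` with density proportional to
`exp (-β ‖x‖)`. -/
def gammaNoise (p : ℕ) (β : ℝ) : Measure (Param p) :=
  (gammaWeight p β Set.univ)⁻¹ • gammaWeight p β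

/-- Gaussian noise `N(0, σ² I)` on `ℝ^p`. -/
def gaussianNoise (p : ℕ) (σ : ℝ) : Measure (Param p) :=
  multivariateGaussian 0 (σ ^ 2 • (1 : Matrix (Fin p) (Fin p) ℝ))

/-- `L̃ = √((√p + √(log δ⁻¹))² + log δ⁻¹)`. -/
def tailRadius (p : ℕ) (δ : ℝ) : ℝ :=
  √((√(p : ℝ) + √(Real.log δ⁻¹)) ^ 2 + Real.log δ⁻¹)

end

end DPTwoStageERM

open MeasureTheory ProbabilityTheory
open Filter Topology

/-! After multiplication by `n` the objective on `D` is `n R + F_D + (n γ / 2) ‖·‖² + ⟨b, ·⟩`, where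
`F_D` is the weighted loss. The weights may all change when one record changes, so `D` is not
compared with `D'` directly: both are compared with the data-free problem without `F_D`, whose
minimizer `m u` depends only on the linear term `u`. By first-order optimality, the estimator on `D`
at the noise `V_D u = u - ∇F_D (m u)` equals `m u`, and `V_D` is a bijection of `ℝ^p`. The preimage
of `S` under the estimator on `D` is thus the image under `V_D` of one set `m ⁻¹' S`, the same for
every dataset.

It remains to compare the transported densities at each `u`. Strong convexity makes `m` Lipschitz,
hence differentiable almost everywhere; `-m'` is symmetric with `0 ≤ -m' ≤ 1/(n γ)`, because `m` is
the gradient of the concave optimal value. So `det V_D' = det (1 + ∇²F_D (-m'))` lies between `1`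
and `exp (tr ∇²F_D / (n γ)) ≤ exp (λ / γ)`. The gradients of `F_D` and `F_{D'}` have norm at most `n
ζ`, so `V_D u` and `V_{D'} u` are at distance at most `2 n ζ`. Only the total weight `n` enters
these bounds.

The constants give `λ / γ ≤ ε / 12`; the density ratio must fit into the rest of `ε`. For Gamma
noise it does so everywhere, for Gaussian noise on the ball of radius `σ L̃`, whose complement has
probability at most `δ`. -/

namespace DPTwoStageERM

/-! ### Convex minimization -/

section ConvexMinimization

variable {E : Type*} [NormedAddCommGroup E] [InnerProductSpace ℝ E]

/-- The difference quotients of a function along a segment converge to the pairing with its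
gradient. -/
theorem tendsto_slope_inner [CompleteSpace E] {φ : E → ℝ} {θ g : E} (hg : HasGradientAt φ g θ)
    (v : E) :
    Tendsto (fun t : ℝ => t⁻¹ * (φ (θ + t • v) - φ θ)) (𝓝[>] 0) (𝓝 (inner ℝ g v)) := by
  have h := (hg.hasFDerivAt.hasLineDerivAt v).tendsto_slope_zero_right
  simpa using h

theorem le_of_convexOn_segment {s : Set E} {ψ : E → ℝ} (hψ : ConvexOn ℝ s ψ) {θ x : E}
    (hθ : θ ∈ s) (hx : x ∈ s) {t : ℝ} (ht0 : 0 ≤ t) (ht1 : t ≤ 1) :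
    ψ (θ + t • (x - θ)) ≤ ψ θ + t * (ψ x - ψ θ) := by
  have := hψ.2 hθ hx (sub_nonneg.2 ht1) ht0 (by ring)
  have e : (1 - t) • θ + t • x = θ + t • (x - θ) := by module
  rw [e] at this
  simp only [smul_eq_mul] at this
  linarith

theorem inner_gradient_le_sub [CompleteSpace E] {s : Set E} {φ : E → ℝ} (hφ : ConvexOn ℝ s φ)
    {θ g x : E} (hg : HasGradientAt φ g θ) (hθ : θ ∈ s) (hx : x ∈ s) :
    inner ℝ g (x - θ) ≤ φ x - φ θ := by
  refine le_of_tendsto (tendsto_slope_inner hg (x - θ)) ?_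
  filter_upwards [Ioo_mem_nhdsGT (zero_lt_one (α := ℝ))] with t ⟨h0, h1⟩
  have h4 := le_of_convexOn_segment hφ hθ hx h0.le h1.le
  rw [inv_mul_eq_div, div_le_iff₀ h0]
  linarith

/-- First-order optimality condition: on a convex set, a differentiable convex summand of the
objective may be replaced by its linearization at the minimizer. -/
theorem isMinOn_add_iff_isMinOn_add_inner [CompleteSpace E] {s : Set E} {h φ : E → ℝ}
    (hh : ConvexOn ℝ s h) (hφ : ConvexOn ℝ s φ) {θ g : E} (hg : HasGradientAt φ g θ)
    (hθ : θ ∈ s) :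
    IsMinOn (fun x => h x + φ x) s θ ↔ IsMinOn (fun x => h x + inner ℝ g x) s θ := by
  simp only [isMinOn_iff]
  constructor
  · intro hmin x hx
    have : h θ - h x ≤ inner ℝ g (x - θ) := by
      refine ge_of_tendsto (tendsto_slope_inner hg (x - θ)) ?_
      filter_upwards [Ioo_mem_nhdsGT (zero_lt_one (α := ℝ))] with t ⟨h0, h1⟩
      have h3 := hmin _ (hh.1.add_smul_sub_mem hθ hx ⟨h0.le, h1.le⟩)
      have h4 := le_of_convexOn_segment hh hθ hx h0.le h1.le
      rw [inv_mul_eq_div, le_div_iff₀ h0]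
      linarith
    rw [inner_sub_right] at this
    linarith
  · intro hmin x hx
    have := inner_gradient_le_sub hφ hg hθ hx
    rw [inner_sub_right] at this
    have := hmin x hx
    linarith

theorem convexOn_inner {s : Set E} (hs : Convex ℝ s) (u : E) :
    ConvexOn ℝ s (fun x : E => inner ℝ u x) :=
  ((innerSL ℝ u).toLinearMap.convexOn hs)

theorem strictConvexOn_add_sq {s : Set E} {h : E → ℝ} (hh : ConvexOn ℝ s h) {g : ℝ}
    (hg : 0 < g) : StrictConvexOn ℝ s (fun x => h x + g / 2 * ‖x‖ ^ 2) := by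
  refine StrongConvexOn.strictConvexOn (m := g) (strongConvexOn_iff_convex.2 ?_) hg
  simpa using hh

theorem convexOn_sq {s : Set E} (hs : Convex ℝ s) {g : ℝ}
    (hg : 0 < g) : ConvexOn ℝ s (fun x => g / 2 * ‖x‖ ^ 2) := by
  simpa using (strictConvexOn_add_sq (convexOn_const 0 hs) hg).convexOn

theorem hasGradientAt_half_mul_norm_sq [CompleteSpace E] (g : ℝ) (x : E) :
    HasGradientAt (fun x : E => g / 2 * ‖x‖ ^ 2) (g • x) x := by
  rw [hasGradientAt_iff_hasFDerivAt]
  refine ((hasStrictFDerivAt_norm_sq x).hasFDerivAt.const_mul (g / 2)).congr_fderiv ?_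
  ext v
  simp
  ring

theorem hasGradientAt_inner [CompleteSpace E] (u x : E) :
    HasGradientAt (fun x : E => inner ℝ u x) u x := by
  rw [hasGradientAt_iff_hasFDerivAt]
  exact (innerSL ℝ u).hasFDerivAt

theorem hasGradientAt_add [CompleteSpace E] {φ ψ : E → ℝ} {a b x : E} (hφ : HasGradientAt φ a x)
    (hψ : HasGradientAt ψ b x) : HasGradientAt (φ + ψ) (a + b) x := by
  rw [hasGradientAt_iff_hasFDerivAt, map_add]
  exact hφ.hasFDerivAt.add hψ.hasFDerivAt

/-- A convex function on a finite-dimensional space decreases at most linearly. -/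
theorem exists_linear_lower_bound [FiniteDimensional ℝ E] {h : E → ℝ}
    (hh : ConvexOn ℝ Set.univ h) : ∃ C : ℝ, ∀ x, -C * (1 + ‖x‖) ≤ h x := by
  have hcont : Continuous h := hh.locallyLipschitz.continuous
  obtain ⟨C, hC⟩ := (isCompact_closedBall (0 : E) 1).exists_bound_of_continuousOn
    hcont.continuousOn
  have hC' : ∀ x, ‖x‖ ≤ 1 → |h x| ≤ C := fun x hx => hC x (by simpa using hx)
  have h0 := hC' 0 (by simp)
  have hC0 : 0 ≤ C := (abs_nonneg _).trans h0
  refine ⟨2 * C, fun x => ?_⟩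
  rcases le_total ‖x‖ 1 with hx | hx
  · have := (abs_le.1 (hC' x hx)).1
    nlinarith [norm_nonneg x]
  · have hpos : 0 < ‖x‖ := by linarith
    have hi : ‖x‖⁻¹ ≤ 1 := inv_le_one_of_one_le₀ hx
    have h1 := hh.2 (Set.mem_univ x) (Set.mem_univ 0) (inv_nonneg.2 hpos.le)
      (sub_nonneg.2 hi) (by ring)
    -- Outside the unit ball, convexity on the segment from `0` to `x` is used at its unit point,
    -- where `h ≥ -C`.
    have h2 := (abs_le.1 (hC' (‖x‖⁻¹ • x + (1 - ‖x‖⁻¹) • 0) (by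
      simp [norm_smul, inv_mul_cancel₀ hpos.ne']))).1
    simp only [smul_eq_mul] at h1
    have h3 := h2.trans h1
    have h4 := (abs_le.1 h0).2
    have h5 : -C ≤ ‖x‖⁻¹ * h x + C := by nlinarith [inv_nonneg.2 hpos.le]
    have h6 : -(2 * C) * ‖x‖ ≤ h x := by
      have := mul_le_mul_of_nonneg_left h5 hpos.le
      rw [mul_add, mul_inv_cancel_left₀ hpos.ne'] at this
      linarith
    linarith

/-- A convex function plus a positive multiple of the squared norm has a unique minimizer over
each nonempty closed convex set. -/
theorem existsUnique_isMinOn_add_sq [FiniteDimensional ℝ E] {s : Set E} (hs : IsClosed s)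
    (hs' : Convex ℝ s) (hne : s.Nonempty) {h : E → ℝ} (hh : ConvexOn ℝ Set.univ h) {g : ℝ}
    (hg : 0 < g) : ∃! θ, θ ∈ s ∧ IsMinOn (fun x => h x + g / 2 * ‖x‖ ^ 2) s θ := by
  have hcont : Continuous (fun x => h x + g / 2 * ‖x‖ ^ 2) :=
    hh.locallyLipschitz.continuous.add (by fun_prop)
  obtain ⟨x₀, hx₀⟩ := hne
  obtain ⟨C, hC⟩ := exists_linear_lower_bound hh
  have hlim : Tendsto (fun x => h x + g / 2 * ‖x‖ ^ 2) (cocompact E) atTop := by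
    have h1 : Tendsto (fun r : ℝ => r * (g / 2 * r - C) + -C) atTop atTop := by
      refine tendsto_atTop_add_const_right _ _ (tendsto_id.atTop_mul_atTop₀ ?_)
      exact tendsto_atTop_add_const_right _ _ (tendsto_id.const_mul_atTop (by positivity))
    refine tendsto_atTop_mono (fun x => ?_) (h1.comp (tendsto_norm_cocompact_atTop (E := E)))
    have := hC x
    simp only [Function.comp_apply]
    nlinarith
  obtain ⟨θ, hθ, hmin⟩ := hcont.continuousOn.exists_isMinOn' hs hx₀
    ((hlim.eventually_ge_atTop _).filter_mono inf_le_left)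
  refine ⟨θ, ⟨hθ, hmin⟩, fun θ' ⟨hθ', hmin'⟩ => ?_⟩
  exact (strictConvexOn_add_sq (hh.subset (Set.subset_univ _) hs') hg).eq_of_isMinOn
    hmin' hmin hθ' hθ

end ConvexMinimization

/-! ### The regularized minimizer as a function of the linear perturbation -/

/-- `m u` minimizes the strongly convex objective `h + g/2 ‖·‖² + ⟨u, ·⟩` over `s`. -/
structure IsRegularizedMinimizer {E : Type*} [NormedAddCommGroup E] [InnerProductSpace ℝ E]
    (s : Set E) (h : E → ℝ) (g : ℝ) (m : E → E) : Prop where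
  mem : ∀ u, m u ∈ s
  isMinOn : ∀ u, IsMinOn (fun x => h x + g / 2 * ‖x‖ ^ 2 + inner ℝ u x) s (m u)

section Regularized

variable {E : Type*} [NormedAddCommGroup E] [InnerProductSpace ℝ E] [CompleteSpace E]
  {s : Set E} {h : E → ℝ} {g : ℝ} {m : E → E}

omit [CompleteSpace E] in
theorem IsRegularizedMinimizer.unique (hm : IsRegularizedMinimizer s h g m)
    (hh : ConvexOn ℝ s h) (hg : 0 < g) {u θ : E} (hθ : θ ∈ s)
    (hmin : IsMinOn (fun x => h x + g / 2 * ‖x‖ ^ 2 + inner ℝ u x) s θ) : m u = θ :=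
  ((strictConvexOn_add_sq hh hg).add_convexOn (convexOn_inner hh.1 u)).eq_of_isMinOn
    (hm.isMinOn u) hmin (hm.mem u) hθ

/-- Cocoercivity of `-m`. Since `h` need not be differentiable, only the smooth part of the
objective is linearized at each minimizer; adding the two variational inequalities cancels `h`. -/
theorem IsRegularizedMinimizer.sq_le (hm : IsRegularizedMinimizer s h g m)
    (hh : ConvexOn ℝ s h) (hg : 0 < g) (u v : E) :
    g * ‖m u - m v‖ ^ 2 ≤ -inner ℝ (u - v) (m u - m v) := by
  have key : ∀ u v, h (m u) + inner ℝ (g • m u + u) (m u) ≤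
      h (m v) + inner ℝ (g • m u + u) (m v) := by
    intro u v
    have h1 := hm.isMinOn u
    simp only [add_assoc] at h1
    have h2 := (isMinOn_add_iff_isMinOn_add_inner hh
      ((convexOn_sq hh.1 hg).add (convexOn_inner hh.1 u))
      (hasGradientAt_add (hasGradientAt_half_mul_norm_sq g (m u)) (hasGradientAt_inner u (m u)))
      (hm.mem u)).1 h1
    exact isMinOn_iff.1 h2 _ (hm.mem v)
  have h1 := key u v
  have h2 := key v u
  have e : ‖m u - m v‖ ^ 2 = inner ℝ (m u - m v) (m u - m v) := (real_inner_self_eq_norm_sq _).symm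
  rw [e]
  simp only [inner_add_left, inner_sub_left, inner_sub_right, inner_smul_left] at *
  simp only [conj_trivial] at *
  linarith

theorem IsRegularizedMinimizer.norm_sub_le (hm : IsRegularizedMinimizer s h g m)
    (hh : ConvexOn ℝ s h) (hg : 0 < g) (u v : E) : ‖m u - m v‖ ≤ g⁻¹ * ‖u - v‖ := by
  have h1 := hm.sq_le hh hg u v
  have h2 := (neg_le_abs _).trans (abs_real_inner_le_norm (u - v) (m u - m v))
  rw [inv_mul_eq_div, le_div_iff₀ hg]
  rcases (norm_nonneg (m u - m v)).eq_or_lt with h0 | h0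
  · rw [← h0]; simp
  · nlinarith

theorem IsRegularizedMinimizer.lipschitzWith (hm : IsRegularizedMinimizer s h g m)
    (hh : ConvexOn ℝ s h) (hg : 0 < g) : LipschitzWith g⁻¹.toNNReal m := by
  refine LipschitzWith.of_dist_le_mul fun u v => ?_
  rw [Real.coe_toNNReal _ (inv_nonneg.2 hg.le), dist_eq_norm, dist_eq_norm]
  exact hm.norm_sub_le hh hg u v

/-- The minimizer is the gradient of the optimal value. -/
theorem IsRegularizedMinimizer.hasGradientAt_value (hm : IsRegularizedMinimizer s h g m)
    (hh : ConvexOn ℝ s h) (hg : 0 < g) (u : E) :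
    HasGradientAt (fun u => h (m u) + g / 2 * ‖m u‖ ^ 2 + inner ℝ u (m u)) (m u) u := by
  rw [hasGradientAt_iff_hasFDerivAt]
  refine HasFDerivAt.of_isLittleO ?_
  -- Testing each minimizer in the other's problem traps the remainder between `⟨v - u, m v - m u⟩`
  -- and `0`, which is quadratic in `v - u` by the Lipschitz bound.
  have hO : (fun v => h (m v) + g / 2 * ‖m v‖ ^ 2 + inner ℝ v (m v) -
      (h (m u) + g / 2 * ‖m u‖ ^ 2 + inner ℝ u (m u)) -
      (InnerProductSpace.toDual ℝ E (m u)) (v - u)) =O[𝓝 u] fun v => ‖v - u‖ ^ 2 := by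
    refine Asymptotics.IsBigO.of_bound g⁻¹ (Eventually.of_forall fun v => ?_)
    have h1 := isMinOn_iff.1 (hm.isMinOn u) _ (hm.mem v)
    have h2 := isMinOn_iff.1 (hm.isMinOn v) _ (hm.mem u)
    have h3 := (abs_real_inner_le_norm (v - u) (m v - m u)).trans
      (mul_le_mul_of_nonneg_left (hm.norm_sub_le hh hg v u) (norm_nonneg _))
    rw [InnerProductSpace.toDual_apply_apply, real_inner_comm (v - u) (m u), Real.norm_eq_abs, Real.norm_eq_abs,
      abs_of_nonneg (sq_nonneg ‖v - u‖)]
    have h4 := (abs_le.1 h3).1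
    have h5 := (abs_le.1 h3).2
    have h6 : 0 ≤ g⁻¹ * ‖v - u‖ ^ 2 := by positivity
    simp only [inner_sub_left, inner_sub_right] at *
    rw [abs_le]
    constructor <;> nlinarith
  refine hO.trans_isLittleO ?_
  have h7 : Tendsto (fun v => v - u) (𝓝 u) (𝓝 0) := by
    have : Continuous (fun v => v - u) := by fun_prop
    simpa using this.tendsto u
  exact (Asymptotics.isLittleO_norm_pow_id (E' := E) one_lt_two).comp_tendsto h7

/-- As `m` is everywhere the gradient of the optimal value, `B` is a second derivative of it, hence
symmetric. -/
theorem IsRegularizedMinimizer.inner_fderiv_comm (hm : IsRegularizedMinimizer s h g m)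
    (hh : ConvexOn ℝ s h) (hg : 0 < g) {u : E} {B : E →L[ℝ] E} (hB : HasFDerivAt m B u)
    (x y : E) : inner ℝ (B x) y = inner ℝ x (B y) := by
  have h1 := second_derivative_symmetric (𝕜 := ℝ)
    (fun v => (hm.hasGradientAt_value hh hg v).hasFDerivAt)
    ((InnerProductSpace.toDual ℝ E).toContinuousLinearEquiv.toContinuousLinearMap.hasFDerivAt.comp
      u hB) x y
  simp only [ContinuousLinearMap.comp_apply] at h1
  change inner ℝ (B x) y = inner ℝ (B y) x at h1
  rw [h1, real_inner_comm]

/-- Infinitesimal form of `IsRegularizedMinimizer.sq_le`: put `u + t • x` against `u`, divide by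
`t²` and let `t` decrease to `0`. -/
theorem IsRegularizedMinimizer.fderiv_sq_le (hm : IsRegularizedMinimizer s h g m)
    (hh : ConvexOn ℝ s h) (hg : 0 < g) {u : E} {B : E →L[ℝ] E} (hB : HasFDerivAt m B u)
    (x : E) : g * ‖B x‖ ^ 2 ≤ -inner ℝ (B x) x := by
  have h1 := (hB.hasLineDerivAt x).tendsto_slope_zero_right
  refine le_of_tendsto_of_tendsto ((h1.norm.pow 2).const_mul g)
    ((h1.inner tendsto_const_nhds (y := x)).neg) ?_
  filter_upwards [self_mem_nhdsWithin] with t ht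
  have ht : 0 < t := ht
  have h2 := hm.sq_le hh hg (u + t • x) u
  simp only [add_sub_cancel_left, inner_smul_left, conj_trivial] at h2
  simp only [norm_smul, inner_smul_left, conj_trivial, Real.norm_eq_abs, abs_inv, abs_of_pos ht]
  rw [real_inner_comm]
  have h3 : (0 : ℝ) < t⁻¹ ^ 2 := by positivity
  have h4 := mul_le_mul_of_nonneg_left h2 h3.le
  have h5 : t⁻¹ ^ 2 * t = t⁻¹ := by field_simp
  calc _ = t⁻¹ ^ 2 * (g * ‖m (u + t • x) - m u‖ ^ 2) := by ring
    _ ≤ _ := h4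
    _ = -((t⁻¹ ^ 2 * t) * inner ℝ x (m (u + t • x) - m u)) := by ring
    _ = _ := by rw [h5]

/-- The negative derivative of the regularized minimizer is positive semidefinite, and at most
`1/g`. -/
theorem IsRegularizedMinimizer.isPositive_neg_fderiv (hm : IsRegularizedMinimizer s h g m)
    (hh : ConvexOn ℝ s h) (hg : 0 < g) {u : E} {B : E →L[ℝ] E} (hB : HasFDerivAt m B u) :
    ((-B : E →L[ℝ] E) : E →ₗ[ℝ] E).IsPositive := by
  refine ⟨fun x y => ?_, fun x => ?_⟩
  · simp [hm.inner_fderiv_comm hh hg hB x y]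
  · have := hm.fderiv_sq_le hh hg hB x
    have h2 : 0 ≤ g * ‖B x‖ ^ 2 := by positivity
    simp only [ContinuousLinearMap.coe_coe, neg_apply, inner_neg_left,
      RCLike.re_to_real]
    linarith

theorem IsRegularizedMinimizer.inner_neg_fderiv_le (hm : IsRegularizedMinimizer s h g m)
    (hh : ConvexOn ℝ s h) (hg : 0 < g) {u : E} {B : E →L[ℝ] E} (hB : HasFDerivAt m B u)
    (x : E) : inner ℝ ((-B) x) x ≤ g⁻¹ * ‖x‖ ^ 2 := by
  have h1 := hm.fderiv_sq_le hh hg hB x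
  have h2 := (neg_le_abs _).trans (abs_real_inner_le_norm (B x) x)
  have h3 : ‖B x‖ ≤ g⁻¹ * ‖x‖ := by
    rw [inv_mul_eq_div, le_div_iff₀ hg]
    rcases (norm_nonneg (B x)).eq_or_lt with h0 | h0
    · rw [← h0]; simp
    · nlinarith
  simp only [neg_apply, inner_neg_left]
  nlinarith [norm_nonneg x]

/-- Shifting the linear perturbation by the gradient of a convex function `F` at the minimizer
amounts to adding `F` to the objective. -/
theorem IsRegularizedMinimizer.apply_sub_gradient {F : E → ℝ} {m' : E → E}
    (hm : IsRegularizedMinimizer s h g m) (hm' : IsRegularizedMinimizer s (fun x => h x + F x) g m')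
    (hh : ConvexOn ℝ s h) (hg : 0 < g) (hF : ConvexOn ℝ s F) (hdF : Differentiable ℝ F) (u : E) :
    m' (u - gradient F (m u)) = m u := by
  refine hm'.unique (hh.add hF) hg (hm.mem u) ?_
  have h1 := (isMinOn_add_iff_isMinOn_add_inner
    (h := fun x => h x + g / 2 * ‖x‖ ^ 2 + inner ℝ (u - gradient F (m u)) x)
    (((strictConvexOn_add_sq hh hg).convexOn).add (convexOn_inner hh.1 _)) hF
    (hdF (m u)).hasGradientAt (hm.mem u)).2 (by
      have := hm.isMinOn u
      convert this using 2 with x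
      rw [inner_sub_left]
      ring)
  convert h1 using 2 with x
  ring

/-- Converse of `apply_sub_gradient`: it supplies the preimage of `b` that makes the
reparametrization surjective. -/
theorem IsRegularizedMinimizer.apply_add_gradient {F : E → ℝ} {m' : E → E}
    (hm : IsRegularizedMinimizer s h g m) (hm' : IsRegularizedMinimizer s (fun x => h x + F x) g m')
    (hh : ConvexOn ℝ s h) (hg : 0 < g) (hF : ConvexOn ℝ s F) (hdF : Differentiable ℝ F) (b : E) :
    m (b + gradient F (m' b)) = m' b := by
  refine hm.unique hh hg (hm'.mem b) ?_
  have h1 := (isMinOn_add_iff_isMinOn_add_inner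
    (h := fun x => h x + g / 2 * ‖x‖ ^ 2 + inner ℝ b x)
    (((strictConvexOn_add_sq hh hg).convexOn).add (convexOn_inner hh.1 _)) hF
    (hdF (m' b)).hasGradientAt (hm'.mem b)).1 (by
      have := hm'.isMinOn b
      convert this using 2 with x
      ring)
  convert h1 using 2 with x
  rw [inner_add_left]
  ring

end Regularized

/-! ### The determinant of `1 + HA` -/

section Determinant

open Matrix
open scoped MatrixOrder

theorem det_one_add_bounds_of_posSemidef {ι : Type*} [Fintype ι] [DecidableEq ι]
    {M : Matrix ι ι ℝ} (hM : M.PosSemidef) :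
    1 ≤ (1 + M).det ∧ (1 + M).det ≤ Real.exp M.trace := by
  have h : (1 + M).det = ∏ i, (1 + hM.1.eigenvalues i) := by
    -- The characteristic polynomial at `-1` is `det (1 + M)` up to the sign `(-1) ^ card ι`, which
    -- also comes out of the eigenvalue product.
    have h1 := eval_charpoly M (-1)
    rw [hM.1.charpoly_eq, Polynomial.eval_prod] at h1
    have h2 : scalar ι (-1 : ℝ) - M = -(1 + M) := by
      rw [map_neg, map_one]; abel
    rw [h2, det_neg] at h1
    have h3 : ∀ i, Polynomial.eval (-1 : ℝ)
        (Polynomial.X - Polynomial.C (RCLike.ofReal (hM.1.eigenvalues i) : ℝ)) =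
        -1 * (1 + hM.1.eigenvalues i) := fun i => by simp; ring
    rw [Finset.prod_congr rfl fun i _ => h3 i, Finset.prod_mul_distrib, Finset.prod_const,
      Finset.card_univ] at h1
    exact (mul_left_cancel₀ (pow_ne_zero _ (by norm_num)) h1).symm
  rw [h]
  constructor
  · simpa using Finset.prod_le_prod (s := Finset.univ) (fun i _ => zero_le_one (α := ℝ))
      fun i _ => (by linarith [hM.eigenvalues_nonneg i] : 1 ≤ 1 + hM.1.eigenvalues i)
  · rw [hM.1.trace_eq_sum_eigenvalues, Real.exp_sum]
    refine Finset.prod_le_prod (fun i _ => by linarith [hM.eigenvalues_nonneg i]) fun i _ => ?_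
    simpa [add_comm] using Real.add_one_le_exp (hM.1.eigenvalues i)

/-- `H * A` need not be symmetric, but with `H = Cᴴ C` Sylvester's identity replaces it by the
positive semidefinite `C A Cᴴ`, whose trace is at most `c tr (C Cᴴ) = c tr H`. -/
theorem det_one_add_mul_bounds {ι : Type*} [Fintype ι] [DecidableEq ι] {H A : Matrix ι ι ℝ}
    (hH : H.PosSemidef) (hA : A.PosSemidef) {c : ℝ} (hc : (c • (1 : Matrix ι ι ℝ) - A).PosSemidef) :
    1 ≤ (1 + H * A).det ∧ (1 + H * A).det ≤ Real.exp (c * H.trace) := by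
  obtain ⟨C, rfl⟩ := CStarAlgebra.nonneg_iff_eq_star_mul_self.1 hH.nonneg
  rw [star_eq_conjTranspose]
  have h1 : (1 + Cᴴ * C * A).det = (1 + C * A * Cᴴ).det := by
    rw [Matrix.mul_assoc, det_one_add_mul_comm]
  have h2 := det_one_add_bounds_of_posSemidef (hA.mul_mul_conjTranspose_same C)
  rw [h1]
  refine ⟨h2.1, h2.2.trans (Real.exp_le_exp.2 ?_)⟩
  have h3 := (hc.mul_mul_conjTranspose_same C).trace_nonneg
  rw [Matrix.mul_sub, Matrix.sub_mul, trace_sub] at h3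
  rw [trace_mul_comm Cᴴ C]
  simp at h3
  exact h3

theorem linearMap_det_one_add_comp_bounds {E : Type*} [NormedAddCommGroup E]
    [InnerProductSpace ℝ E] [FiniteDimensional ℝ E] {H A : E →ₗ[ℝ] E} (hH : H.IsPositive)
    (hA : A.IsPositive) {c : ℝ} (hc : ∀ x, inner ℝ (A x) x ≤ c * ‖x‖ ^ 2) :
    1 ≤ LinearMap.det (1 + H * A) ∧
      LinearMap.det (1 + H * A) ≤ Real.exp (c * LinearMap.trace ℝ E H) := by
  let b := stdOrthonormalBasis ℝ E
  have hcA : (c • (1 : E →ₗ[ℝ] E) - A).IsPositive := by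
    refine ⟨fun x y => ?_, fun x => ?_⟩
    · have := hA.1 x y
      simp [inner_sub_left, inner_sub_right, inner_smul_left, inner_smul_right, this]
    · have := hc x
      simp [inner_sub_left, inner_smul_left]
      linarith
  have h := det_one_add_mul_bounds ((LinearMap.posSemidef_toMatrix_iff b).2 hH)
    ((LinearMap.posSemidef_toMatrix_iff b).2 hA) (c := c) (by
      have := (LinearMap.posSemidef_toMatrix_iff b).2 hcA
      simpa [LinearMap.toMatrix_one] using this)
  rw [← LinearMap.det_toMatrix b.toBasis, LinearMap.trace_eq_matrix_trace ℝ b.toBasis]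
  simpa [LinearMap.toMatrix_one, LinearMap.toMatrix_mul] using h

end Determinant

/-! ### Change of variables -/

section ChangeOfVariables

/-- Lipschitz maps distort Hausdorff measure by at most a constant factor, and in full dimension
Hausdorff and Haar measure are multiples of each other. A countable cover reduces the local case to
this one. -/
theorem addHaar_image_eq_zero_of_locallyLipschitz {E : Type*} [NormedAddCommGroup E]
    [NormedSpace ℝ E] [FiniteDimensional ℝ E] [MeasurableSpace E] [BorelSpace E] (μ : Measure E)
    [μ.IsAddHaarMeasure] {f : E → E} (hf : LocallyLipschitz f) {s : Set E} (hs : μ s = 0) :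
    μ (f '' s) = 0 := by
  have hμ : μ = μ.addHaarScalarFactor (μH[Module.finrank ℝ E]) • μH[Module.finrank ℝ E] :=
    Measure.isAddLeftInvariant_eq_smul _ _
  have hμ' : (μH[Module.finrank ℝ E] : Measure E) =
      (μH[Module.finrank ℝ E] : Measure E).addHaarScalarFactor μ • μ :=
    Measure.isAddLeftInvariant_eq_smul _ _
  have hs' : (μH[Module.finrank ℝ E] : Measure E) s = 0 := by
    rw [hμ']; simp [hs]
  suffices h : (μH[Module.finrank ℝ E] : Measure E) (f '' s) = 0 by
    rw [hμ]; simp [h]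
  choose K t ht hKt using hf
  obtain ⟨c, hc, hcover⟩ := TopologicalSpace.countable_cover_nhds ht
  have hsub : f '' s ⊆ ⋃ x ∈ c, f '' (s ∩ t x) := by
    rintro _ ⟨x, hx, rfl⟩
    have : x ∈ ⋃ y ∈ c, t y := by rw [hcover]; trivial
    simp only [Set.mem_iUnion] at this ⊢
    obtain ⟨y, hy, hxy⟩ := this
    exact ⟨y, hy, x, ⟨hx, hxy⟩, rfl⟩
  refine measure_mono_null hsub ((measure_biUnion_null_iff hc).2 fun x _ => ?_)
  have h1 := ((hKt x).mono Set.inter_subset_right : LipschitzOnWith (K x) f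
    (s ∩ t x)).hausdorffMeasure_image_le (d := Module.finrank ℝ E) (by positivity)
  rw [measure_mono_null Set.inter_subset_left hs', mul_zero] at h1
  exact le_antisymm h1 bot_le

/-- Change of variables for an injective locally Lipschitz map that is differentiable off a null
set. -/
theorem lintegral_image_eq_of_locallyLipschitz {E : Type*} [NormedAddCommGroup E]
    [NormedSpace ℝ E] [FiniteDimensional ℝ E] [MeasurableSpace E] [BorelSpace E] (μ : Measure E)
    [μ.IsAddHaarMeasure] {V : E → E} (hV : LocallyLipschitz V) (hinj : Function.Injective V)
    {N : Set E} (hN : MeasurableSet N) (hN0 : μ Nᶜ = 0) {V' : E → E →L[ℝ] E}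
    (hV' : ∀ u ∈ N, HasFDerivAt V (V' u) u) (f : E → ENNReal) {s : Set E} (hs : MeasurableSet s) :
    ∫⁻ x in V '' s, f x ∂μ =
      ∫⁻ u in s ∩ N, ENNReal.ofReal |(V' u).det| * f (V u) ∂μ := by
  rw [← lintegral_image_eq_lintegral_abs_det_fderiv_mul μ (hs.inter hN)
    (fun u hu => (hV' u hu.2).hasFDerivWithinAt) hinj.injOn f]
  refine setLIntegral_congr ?_
  refine EventuallyLE.antisymm ?_ (Set.image_mono Set.inter_subset_left).eventuallyLE
  have h0 : μ (V '' Nᶜ) = 0 := addHaar_image_eq_zero_of_locallyLipschitz μ hV hN0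
  refine ae_le_set.2 (measure_mono_null ?_ h0)
  rintro _ ⟨⟨u, hu, rfl⟩, hu'⟩
  exact ⟨u, fun hN => hu' ⟨u, ⟨hu, hN⟩, rfl⟩, rfl⟩

/-- Comparison of the laws of `m₁` and `m₂` under the measure with density `f`, restricted to a
good set `G`, when both are reparametrizations of a common map `m`. -/
theorem withDensity_preimage_le_of_reparametrization {E : Type*} [NormedAddCommGroup E]
    [NormedSpace ℝ E] [FiniteDimensional ℝ E] [MeasurableSpace E] [BorelSpace E] (μ : Measure E)
    [μ.IsAddHaarMeasure] {m m₁ m₂ V₁ V₂ : E → E} (hm : Measurable m)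
    (hm₁ : Measurable m₁) (hm₂ : Measurable m₂)
    (h₁ : Function.Bijective V₁) (h₂ : Function.Bijective V₂)
    (hV₁ : LocallyLipschitz V₁) (hV₂ : LocallyLipschitz V₂)
    (hmV₁ : ∀ u, m₁ (V₁ u) = m u) (hmV₂ : ∀ u, m₂ (V₂ u) = m u)
    {N : Set E} (hN : MeasurableSet N) (hN0 : μ Nᶜ = 0) {V₁' V₂' : E → E →L[ℝ] E}
    (hV₁' : ∀ u ∈ N, HasFDerivAt V₁ (V₁' u) u) (hV₂' : ∀ u ∈ N, HasFDerivAt V₂ (V₂' u) u)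
    {f : E → ENNReal} {G : Set E} (hG : MeasurableSet G) {c : ENNReal}
    (hc : c ≠ ⊤)
    (hle : ∀ u ∈ N, V₁ u ∈ G → ENNReal.ofReal |(V₁' u).det| * f (V₁ u) ≤
      c * (ENNReal.ofReal |(V₂' u).det| * f (V₂ u))) {S : Set E} (hS : MeasurableSet S) :
    μ.withDensity f (m₁ ⁻¹' S ∩ G) ≤ c * μ.withDensity f (m₂ ⁻¹' S) := by
  have e₁ : m₁ ⁻¹' S ∩ G = V₁ '' (m ⁻¹' S ∩ V₁ ⁻¹' G) := by
    have : m ⁻¹' S ∩ V₁ ⁻¹' G = V₁ ⁻¹' (m₁ ⁻¹' S ∩ G) := by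
      ext u; simp [hmV₁]
    rw [this, Set.image_preimage_eq _ h₁.2]
  have e₂ : m₂ ⁻¹' S = V₂ '' (m ⁻¹' S) := by
    have : m ⁻¹' S = V₂ ⁻¹' (m₂ ⁻¹' S) := by
      ext u; simp [hmV₂]
    rw [this, Set.image_preimage_eq _ h₂.2]
  have hmG : MeasurableSet (m ⁻¹' S ∩ V₁ ⁻¹' G) :=
    (hm hS).inter (hV₁.continuous.measurable hG)
  rw [withDensity_apply _ ((hm₁ hS).inter hG), withDensity_apply _ (hm₂ hS), e₂, e₁,
    lintegral_image_eq_of_locallyLipschitz μ hV₁ h₁.1 hN hN0 hV₁' f hmG,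
    lintegral_image_eq_of_locallyLipschitz μ hV₂ h₂.1 hN hN0 hV₂' f (hm hS),
    ← lintegral_const_mul' _ _ hc]
  -- Both integrals now run over the common variable `u`, so a pointwise comparison suffices; `G`
  -- restricts only the left one.
  refine (setLIntegral_mono' (hmG.inter hN) fun u hu => hle u hu.2 hu.1.2).trans ?_
  exact lintegral_mono_set (Set.inter_subset_inter_left _ Set.inter_subset_left)

end ChangeOfVariables

/-! ### Gaussian noise -/

section Gaussian

theorem lintegral_exp_neg_mul_sq_norm (p : ℕ) {b : ℝ} (hb : 0 < b) :
    ∫⁻ x : Param p, ENNReal.ofReal (Real.exp (-b * ‖x‖ ^ 2)) =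
      ENNReal.ofReal ((Real.pi / b) ^ ((p : ℝ) / 2)) := by
  have hint : Integrable (fun x : Param p => Real.exp (-b * ‖x‖ ^ 2)) := by
    have h := (GaussianFourier.integrable_cexp_neg_mul_sq_norm_add (V := Param p)
      (b := (b : ℂ)) (by simpa using hb) 0 0).re
    refine h.congr (Eventually.of_forall fun x => ?_)
    simp only [zero_mul, add_zero, RCLike.re_to_complex]
    rw [← Complex.ofReal_neg, ← Complex.ofReal_pow, ← Complex.ofReal_mul, Complex.exp_ofReal_re]
  rw [← ofReal_integral_eq_lintegral_ofReal hint (Eventually.of_forall fun x => (Real.exp_pos _).le),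
    GaussianFourier.integral_rexp_neg_mul_sq_norm hb, finrank_euclideanSpace_fin]

/-- The measure on `ℝ^p` with density `exp (-b ‖x‖²)`. -/
noncomputable def gaussianWeight (p : ℕ) (b : ℝ) : Measure (Param p) :=
  (volume : Measure (Param p)).withDensity fun x => ENNReal.ofReal (Real.exp (-b * ‖x‖ ^ 2))

/-- Both sides are finite measures with the same characteristic function. This provides the density
that the change of variables needs. -/
theorem gaussianNoise_eq_smul_gaussianWeight (p : ℕ) {σ : ℝ} (hσ : 0 < σ) :
    gaussianNoise p σ = ENNReal.ofReal ((1 / (2 * σ ^ 2) / Real.pi) ^ ((p : ℝ) / 2)) •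
      gaussianWeight p (1 / (2 * σ ^ 2)) := by
  set b : ℝ := 1 / (2 * σ ^ 2) with hbdef
  have hb : 0 < b := by positivity
  have hfin : IsFiniteMeasure (gaussianWeight p b) := by
    refine ⟨?_⟩
    rw [gaussianWeight, withDensity_apply _ MeasurableSet.univ, Measure.restrict_univ,
      lintegral_exp_neg_mul_sq_norm p hb]
    exact ENNReal.ofReal_lt_top
  have hfin' : IsFiniteMeasure (ENNReal.ofReal ((b / Real.pi) ^ ((p : ℝ) / 2)) •
      gaussianWeight p b) := by
    refine ⟨?_⟩
    rw [Measure.smul_apply, smul_eq_mul]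
    exact ENNReal.mul_lt_top ENNReal.ofReal_lt_top (measure_lt_top _ _)
  have hg : IsGaussian (gaussianNoise p σ) := by
    unfold gaussianNoise; infer_instance
  refine Measure.ext_of_charFun (funext fun t => ?_)
  have hS : (σ ^ 2 • (1 : Matrix (Fin p) (Fin p) ℝ)).PosSemidef :=
    Matrix.PosSemidef.one.smul (sq_nonneg σ)
  rw [gaussianNoise, charFun_multivariateGaussian hS, charFun_apply, integral_smul_measure,
    gaussianWeight, integral_withDensity_eq_integral_toReal_smul (by fun_prop)
      (Eventually.of_forall fun _ => ENNReal.ofReal_lt_top)]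
  have h1 : ∀ x : Param p, (ENNReal.ofReal (Real.exp (-b * ‖x‖ ^ 2))).toReal •
      Complex.exp (inner ℝ x t * Complex.I) =
      Complex.exp (-(b : ℂ) * ‖x‖ ^ 2 + Complex.I * inner ℝ t x) := by
    intro x
    rw [ENNReal.toReal_ofReal (Real.exp_pos _).le, Complex.real_smul, Complex.ofReal_exp,
      ← Complex.exp_add, real_inner_comm]
    push_cast
    ring_nf
  simp_rw [h1]
  rw [GaussianFourier.integral_cexp_neg_mul_sq_norm_add (by simpa using hb),
    ENNReal.toReal_ofReal (by positivity), finrank_euclideanSpace_fin]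
  have h2 : (((b / Real.pi) ^ ((p : ℝ) / 2) : ℝ) : ℂ) * (Real.pi / b : ℂ) ^ ((p : ℂ) / 2) = 1 := by
    have : (Real.pi / b : ℂ) ^ ((p : ℂ) / 2) = (((Real.pi / b) ^ ((p : ℝ) / 2) : ℝ) : ℂ) := by
      rw [Complex.ofReal_cpow (by positivity)]
      push_cast
      rfl
    rw [this, ← Complex.ofReal_mul, ← Real.mul_rpow (by positivity) (by positivity)]
    have : b / Real.pi * (Real.pi / b) = 1 := by
      field_simp
    rw [this]
    simp
  rw [Complex.real_smul, ← mul_assoc, h2, one_mul]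
  congr 1
  have h3 : (t.ofLp ⬝ᵥ (σ ^ 2 • (1 : Matrix (Fin p) (Fin p) ℝ)).mulVec t.ofLp) = σ ^ 2 * ‖t‖ ^ 2 := by
    rw [Matrix.smul_mulVec, Matrix.one_mulVec, dotProduct_smul, smul_eq_mul,
      EuclideanSpace.real_norm_sq_eq]
    simp [dotProduct, sq]
  rw [h3, inner_zero_right, hbdef]
  push_cast
  rw [Complex.I_sq]
  have : (σ : ℂ) ≠ 0 := by exact_mod_cast hσ.ne'
  field_simp
  ring

/-- This is `x ≤ sinh x` at `x = log y`. -/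
theorem log_le_half_sub_inv {y : ℝ} (hy : 1 ≤ y) : Real.log y ≤ (y - y⁻¹) / 2 := by
  have h := Real.self_le_sinh_iff.2 (Real.log_nonneg hy)
  rwa [Real.sinh_log (by linarith)] at h

/-- Chernoff bound for the norm of a Gaussian vector. -/
theorem gaussianNoise_norm_gt_le (p : ℕ) {σ : ℝ} (hσ : 0 < σ) {c r : ℝ} (hc0 : 0 ≤ c)
    (hc : c < 1) (hr : 0 ≤ r) :
    gaussianNoise p σ {x | σ * r < ‖x‖} ≤
      ENNReal.ofReal (Real.exp (-(c * r ^ 2 / 2)) * (1 - c)⁻¹ ^ ((p : ℝ) / 2)) := by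
  set b : ℝ := 1 / (2 * σ ^ 2) with hbdef
  have hb : 0 < b := by positivity
  have hc1 : 0 < 1 - c := by linarith
  rw [gaussianNoise_eq_smul_gaussianWeight p hσ, Measure.smul_apply, smul_eq_mul, gaussianWeight,
    withDensity_apply _ (measurableSet_lt measurable_const measurable_norm), ← hbdef]
  have h1 : ∫⁻ x in {x : Param p | σ * r < ‖x‖}, ENNReal.ofReal (Real.exp (-b * ‖x‖ ^ 2)) ≤
      ENNReal.ofReal (Real.exp (-(c * r ^ 2 / 2))) *
        ENNReal.ofReal ((Real.pi / (b * (1 - c))) ^ ((p : ℝ) / 2)) := by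
    rw [← lintegral_exp_neg_mul_sq_norm p (mul_pos hb hc1), ← lintegral_const_mul' _ _
      ENNReal.ofReal_ne_top]
    refine (setLIntegral_mono' (measurableSet_lt measurable_const measurable_norm)
      fun x hx => ?_).trans (setLIntegral_le_lintegral _ _)
    rw [← ENNReal.ofReal_mul (Real.exp_pos _).le, ← Real.exp_add]
    refine ENNReal.ofReal_le_ofReal (Real.exp_le_exp.2 ?_)
    have hx : σ * r < ‖x‖ := hx
    have h2 : (σ * r) ^ 2 ≤ ‖x‖ ^ 2 := pow_le_pow_left₀ (by positivity) hx.le 2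
    have h3 : b * (σ * r) ^ 2 = r ^ 2 / 2 := by rw [hbdef]; field_simp
    have h4 := mul_le_mul_of_nonneg_left h2 (mul_nonneg hc0 hb.le)
    nlinarith
  refine (mul_le_mul_right h1 _).trans ?_
  rw [← ENNReal.ofReal_mul (Real.exp_pos _).le, ← ENNReal.ofReal_mul (by positivity)]
  refine ENNReal.ofReal_le_ofReal (le_of_eq ?_)
  rw [mul_left_comm, ← Real.mul_rpow (by positivity) (by positivity)]
  congr 2
  field_simp

/-- Tail bound for the norm of a Gaussian vector at the radius `σ L̃`. -/
theorem gaussianNoise_norm_gt_tailRadius_le (p : ℕ) {σ δ : ℝ} (hσ : 0 < σ) (hδ : 0 < δ)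
    (hδ1 : δ ≤ 1) :
    gaussianNoise p σ {x | σ * tailRadius p δ < ‖x‖} ≤ ENNReal.ofReal δ := by
  have hr : 0 ≤ tailRadius p δ := Real.sqrt_nonneg _
  rcases p.eq_zero_or_pos with rfl | hp
  · have : {x : Param 0 | σ * tailRadius 0 δ < ‖x‖} = ∅ := by
      ext x
      simp only [Set.mem_ofPred_eq, Set.mem_empty_iff_false, iff_false, not_lt]
      rw [Subsingleton.elim x 0, norm_zero]
      positivity
    rw [this]; simp
  have ht : 0 ≤ Real.log δ⁻¹ := Real.log_nonneg ((one_le_inv₀ hδ).2 hδ1)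
  set T := √(Real.log δ⁻¹) with hT
  set P := √(p : ℝ) with hP
  have hP0 : 0 < P := Real.sqrt_pos.2 (by exact_mod_cast hp)
  have hT0 : 0 ≤ T := Real.sqrt_nonneg _
  have hT2 : T ^ 2 = Real.log δ⁻¹ := Real.sq_sqrt ht
  have hP2 : P ^ 2 = p := Real.sq_sqrt (by positivity)
  have hr2 : tailRadius p δ ^ 2 = (P + T) ^ 2 + T ^ 2 := by
    rw [tailRadius, Real.sq_sqrt (by positivity), hT2]
  have hPT : 0 < P + 2 * T := by positivity
  have hc : (1 - 2 * T / (P + 2 * T))⁻¹ = (P + 2 * T) / P := by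
    rw [inv_eq_iff_eq_inv, inv_div]
    field_simp
    ring
  -- With this tilt `(1 - c)⁻¹ = 1 + 2T/P`, and bounding its logarithm by `log_le_half_sub_inv`
  -- leaves exactly the exponent `-T² = log δ`.
  refine (gaussianNoise_norm_gt_le p hσ (c := 2 * T / (P + 2 * T)) (by positivity)
    (by rw [div_lt_one hPT]; linarith) hr).trans (ENNReal.ofReal_le_ofReal ?_)
  have hy : 1 ≤ (P + 2 * T) / P := by rw [le_div_iff₀ hP0]; linarith
  rw [hc, hr2, Real.rpow_def_of_pos (by positivity), ← Real.exp_add]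
  have hδ' : δ = Real.exp (-T ^ 2) := by
    rw [hT2, Real.log_inv, neg_neg, Real.exp_log hδ]
  conv_rhs => rw [hδ']
  refine Real.exp_le_exp.2 ?_
  have hlog := mul_le_mul_of_nonneg_right (log_le_half_sub_inv hy)
    (by positivity : (0 : ℝ) ≤ (p : ℝ) / 2)
  have e : ((P + 2 * T) / P - ((P + 2 * T) / P)⁻¹) / 2 * ((p : ℝ) / 2) =
      2 * T / (P + 2 * T) * ((P + T) ^ 2 + T ^ 2) / 2 - T ^ 2 := by
    rw [← hP2]
    field_simp
    ring
  linarith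

end Gaussian

/-! ### Hessians -/

section Hessian

variable {p : ℕ} {f : Param p → ℝ}

theorem contDiff_gradient (hf : ContDiff ℝ 2 f) : ContDiff ℝ 1 (gradient f) :=
  (InnerProductSpace.toDual ℝ (Param p)).symm.toContinuousLinearEquiv.contDiff.comp
    (hf.fderiv_right (m := 1) (by norm_num))

theorem inner_fderiv_gradient (hf : ContDiff ℝ 2 f) (θ x y : Param p) :
    inner ℝ (fderiv ℝ (gradient f) θ x) y = fderiv ℝ (fderiv ℝ f) θ x y := by
  have hd : DifferentiableAt ℝ (fderiv ℝ f) θ :=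
    (hf.fderiv_right (m := 1) (by norm_num)).differentiable one_ne_zero θ
  have h : HasFDerivAt (gradient f)
      ((InnerProductSpace.toDual ℝ (Param p)).symm.toContinuousLinearEquiv.toContinuousLinearMap ∘L
        fderiv ℝ (fderiv ℝ f) θ) θ :=
    (InnerProductSpace.toDual ℝ (Param p)).symm.toContinuousLinearEquiv.hasFDerivAt.comp θ
      hd.hasFDerivAt
  rw [h.fderiv]
  exact InnerProductSpace.toDual_symm_apply

theorem trace_fderiv_gradient (hf : ContDiff ℝ 2 f) (θ : Param p) :
    LinearMap.trace ℝ (Param p) (fderiv ℝ (gradient f) θ) = (hessian f θ).trace := by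
  rw [LinearMap.trace_eq_sum_inner _ (EuclideanSpace.basisFun (Fin p) ℝ), Matrix.trace]
  refine Finset.sum_congr rfl fun i _ => ?_
  rw [real_inner_comm, ContinuousLinearMap.coe_coe, inner_fderiv_gradient hf, Matrix.diag_apply,
    hessian, Matrix.of_apply, iteratedFDeriv_two_apply]
  simp

theorem isPositive_fderiv_gradient (hf : ContDiff ℝ 2 f) (hc : ConvexOn ℝ Set.univ f)
    (θ : Param p) : (fderiv ℝ (gradient f) θ : Param p →ₗ[ℝ] Param p).IsPositive := by
  have hdf : Differentiable ℝ f := hf.differentiable two_ne_zero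
  refine ⟨fun x y => ?_, fun x => ?_⟩
  · simp only [ContinuousLinearMap.coe_coe]
    rw [real_inner_comm _ x, inner_fderiv_gradient hf, inner_fderiv_gradient hf]
    exact second_derivative_symmetric (𝕜 := ℝ) (fun y => (hdf y).hasFDerivAt)
      ((hf.fderiv_right (m := 1) (by norm_num)).differentiable one_ne_zero θ).hasFDerivAt x y
  -- Positivity is the limit of the monotonicity of the gradient along the ray `θ + t • x`.
  · have h1 := (((contDiff_gradient hf).differentiable one_ne_zero θ).hasFDerivAt.hasLineDerivAt
      x).tendsto_slope_zero_right
    refine ge_of_tendsto (h1.inner tendsto_const_nhds (y := x)) ?_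
    filter_upwards [self_mem_nhdsWithin] with t ht
    have ht : 0 < t := ht
    have h2 := inner_gradient_le_sub hc (hdf θ).hasGradientAt (Set.mem_univ θ)
      (Set.mem_univ (θ + t • x))
    have h3 := inner_gradient_le_sub hc (hdf (θ + t • x)).hasGradientAt
      (Set.mem_univ (θ + t • x)) (Set.mem_univ θ)
    simp only [add_sub_cancel_left, sub_add_cancel_left, inner_neg_right, inner_smul_right] at h2 h3
    rw [inner_smul_left, inner_sub_left]
    have h4 : 0 ≤ t * (inner ℝ (gradient f (θ + t • x)) x - inner ℝ (gradient f θ) x) := by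
      linarith
    exact mul_nonneg (inv_nonneg.2 ht.le) (nonneg_of_mul_nonneg_right h4 ht)

end Hessian

/-! ### Privacy of the two-stage estimator -/

theorem argminOn_spec {p : ℕ} {s : Set (Param p)} {f : Param p → ℝ}
    (h : ∃ θ, θ ∈ s ∧ IsMinOn f s θ) : argminOn s f ∈ s ∧ IsMinOn f s (argminOn s f) := by
  rw [argminOn, dif_pos h]
  exact h.choose_spec

/-- The weighted sum of losses `∑ w_i ℓ(θ; d_i)`. -/
noncomputable def weightedLoss {p n : ℕ} {X : Type*} (ℓ : X → Param p → ℝ)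
    (w : (Fin n → X) → Fin n → ℝ) (D : Fin n → X) (θ : Param p) : ℝ :=
  ∑ i, w D i * ℓ (D i) θ

section WeightedLoss

variable {p n : ℕ} {X : Type*} {ℓ : X → Param p → ℝ} {w : (Fin n → X) → Fin n → ℝ}

theorem convexOn_weightedLoss (hℓ : ∀ d, ConvexOn ℝ Set.univ (ℓ d))
    (hw : ∀ D, w D ∈ weightSimplex n) (D : Fin n → X) :
    ConvexOn ℝ Set.univ (weightedLoss ℓ w D) := by
  have : ∀ t : Finset (Fin n), ConvexOn ℝ Set.univ fun θ => ∑ i ∈ t, w D i * ℓ (D i) θ := by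
    intro t
    induction t using Finset.cons_induction with
    | empty => simpa using convexOn_const 0 convex_univ
    | cons i t hi ih =>
      simp only [Finset.sum_cons]
      exact ((hℓ (D i)).smul ((hw D).1 i)).add ih
  exact this Finset.univ

theorem contDiff_weightedLoss (hℓ : ∀ d, ContDiff ℝ 2 (ℓ d)) (D : Fin n → X) :
    ContDiff ℝ 2 (weightedLoss ℓ w D) :=
  ContDiff.sum fun i _ => contDiff_const.mul (hℓ (D i))

theorem gradient_weightedLoss (hℓ : ∀ d, ContDiff ℝ 2 (ℓ d)) (D : Fin n → X) :
    gradient (weightedLoss ℓ w D) = fun θ => ∑ i, w D i • gradient (ℓ (D i)) θ := by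
  refine gradient_eq fun θ => ?_
  rw [hasGradientAt_iff_hasFDerivAt, map_sum]
  refine HasFDerivAt.fun_sum fun i _ => ?_
  have h := (((hℓ (D i)).differentiable two_ne_zero θ).hasFDerivAt).const_mul (w D i)
  rwa [map_smul, toDual_gradient]

theorem norm_gradient_weightedLoss_le (hℓ : ∀ d, ContDiff ℝ 2 (ℓ d))
    (hw : ∀ D, w D ∈ weightSimplex n) {ζ : ℝ} {θ : Param p} (hζ : ∀ d, ‖gradient (ℓ d) θ‖ ≤ ζ)
    (D : Fin n → X) : ‖gradient (weightedLoss ℓ w D) θ‖ ≤ n * ζ := by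
  rw [gradient_weightedLoss hℓ, ← (hw D).2, Finset.sum_mul]
  refine norm_sum_le_of_le _ fun i _ => ?_
  rw [norm_smul, Real.norm_of_nonneg ((hw D).1 i)]
  exact mul_le_mul_of_nonneg_left (hζ _) ((hw D).1 i)

theorem trace_fderiv_gradient_weightedLoss_le (hℓ : ∀ d, ContDiff ℝ 2 (ℓ d))
    (hw : ∀ D, w D ∈ weightSimplex n) {lam : ℝ} {θ : Param p}
    (hlam : ∀ d, (hessian (ℓ d) θ).trace ≤ lam) (D : Fin n → X) :
    LinearMap.trace ℝ (Param p) (fderiv ℝ (gradient (weightedLoss ℓ w D)) θ) ≤ n * lam := by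
  have h : HasFDerivAt (gradient (weightedLoss ℓ w D))
      (∑ i, w D i • fderiv ℝ (gradient (ℓ (D i))) θ) θ := by
    rw [gradient_weightedLoss hℓ]
    exact HasFDerivAt.fun_sum fun i _ =>
      ((contDiff_gradient (hℓ (D i))).differentiable one_ne_zero θ).hasFDerivAt.fun_const_smul _
  rw [h.fderiv, ContinuousLinearMap.toLinearMap_sum, map_sum, ← (hw D).2, Finset.sum_mul]
  refine Finset.sum_le_sum fun i _ => ?_
  rw [ContinuousLinearMap.toLinearMap_smul, map_smul, trace_fderiv_gradient (hℓ _), smul_eq_mul]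
  exact mul_le_mul_of_nonneg_left (hlam _) ((hw D).1 i)

theorem mul_privObjective (hn : 0 < n) (R : Param p → ℝ) (γ : ℝ) (D : Fin n → X)
    (b θ : Param p) : (n : ℝ) * privObjective ℓ R w γ D b θ =
      n * R θ + weightedLoss ℓ w D θ + n * γ / 2 * ‖θ‖ ^ 2 + inner ℝ b θ := by
  have : (n : ℝ) ≠ 0 := by exact_mod_cast hn.ne'
  rw [privObjective, weightedLoss]
  field_simp
  ring

theorem isMinOn_privObjective_iff (hn : 0 < n) {R : Param p → ℝ} {γ : ℝ} {D : Fin n → X}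
    {b θ : Param p} {Θ : Set (Param p)} : IsMinOn (privObjective ℓ R w γ D b) Θ θ ↔
      IsMinOn (fun θ => n * R θ + weightedLoss ℓ w D θ + n * γ / 2 * ‖θ‖ ^ 2 + inner ℝ b θ) Θ θ := by
  have : (0 : ℝ) < n := by exact_mod_cast hn
  simp only [isMinOn_iff, ← mul_privObjective hn, mul_le_mul_iff_right₀ this]

variable {Θ : Set (Param p)} {R : Param p → ℝ} {γ : ℝ}

theorem convexOn_natCast_mul {s : Set (Param p)} (hR : ConvexOn ℝ s R) (n : ℕ) :
    ConvexOn ℝ s fun θ => n * R θ :=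
  hR.smul n.cast_nonneg

theorem existsUnique_isMinOn_add_sq_add_inner (hΘc : IsClosed Θ) (hΘ : Convex ℝ Θ)
    (hne : Θ.Nonempty) {h : Param p → ℝ} (hh : ConvexOn ℝ Set.univ h) {g : ℝ} (hg : 0 < g)
    (u : Param p) :
    ∃! θ, θ ∈ Θ ∧ IsMinOn (fun x => h x + g / 2 * ‖x‖ ^ 2 + inner ℝ u x) Θ θ := by
  have := existsUnique_isMinOn_add_sq hΘc hΘ hne (hh.add (convexOn_inner convex_univ u)) hg
  simpa only [Pi.add_apply, add_right_comm] using this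

theorem existsUnique_isMinOn_privObjective (hn : 0 < n) (hΘc : IsClosed Θ) (hΘ : Convex ℝ Θ)
    (hne : Θ.Nonempty) (hℓ : ∀ d, ConvexOn ℝ Set.univ (ℓ d)) (hR : ConvexOn ℝ Set.univ R)
    (hw : ∀ D, w D ∈ weightSimplex n) (hγ : 0 < γ) (D : Fin n → X) (b : Param p) :
    ∃! θ, θ ∈ Θ ∧ IsMinOn (privObjective ℓ R w γ D b) Θ θ := by
  have hn' : (0 : ℝ) < n := by exact_mod_cast hn
  simp only [isMinOn_privObjective_iff hn]
  exact existsUnique_isMinOn_add_sq_add_inner hΘc hΘ hne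
    ((convexOn_natCast_mul hR n).add (convexOn_weightedLoss hℓ hw D)) (by positivity) b

/-- Privacy on a good set `G` of noise vectors, for a noise density `f` with bounded ratios. -/
theorem withDensity_privEstimator_le (hn : 0 < n) (hΘc : IsClosed Θ) (hΘ : Convex ℝ Θ)
    (hne : Θ.Nonempty) (hℓ : ∀ d, ConvexOn ℝ Set.univ (ℓ d)) (hℓ' : ∀ d, ContDiff ℝ 2 (ℓ d))
    (hR : ConvexOn ℝ Set.univ R) (hw : ∀ D, w D ∈ weightSimplex n) (hγ : 0 < γ)
    {lam ζ : ℝ} (hlam : ∀ d, ∀ θ ∈ Θ, (hessian (ℓ d) θ).trace ≤ lam)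
    (hζ : ∀ d, ∀ θ ∈ Θ, ‖gradient (ℓ d) θ‖ ≤ ζ) {f : Param p → ENNReal}
    {G : Set (Param p)} (hG : MeasurableSet G) {ε : ℝ}
    (hf : ∀ b b' : Param p, b ∈ G → ‖b' - b‖ ≤ 2 * n * ζ →
      ENNReal.ofReal (Real.exp (lam / γ)) * f b ≤ ENNReal.ofReal (Real.exp ε) * f b')
    (D D' : Fin n → X) {S : Set (Param p)} (hS : MeasurableSet S) :
    (volume : Measure (Param p)).withDensity f (privEstimator Θ ℓ R w γ D ⁻¹' S ∩ G) ≤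
      ENNReal.ofReal (Real.exp ε) *
        (volume : Measure (Param p)).withDensity f (privEstimator Θ ℓ R w γ D' ⁻¹' S) := by
  have hn' : (0 : ℝ) < n := by exact_mod_cast hn
  have hg : 0 < n * γ := by positivity
  have hh : ConvexOn ℝ Set.univ fun θ => n * R θ := convexOn_natCast_mul hR n
  have hhΘ : ConvexOn ℝ Θ fun θ => n * R θ := hh.subset (Set.subset_univ _) hΘ
  have hF : ∀ D, ConvexOn ℝ Set.univ (weightedLoss ℓ w D) := convexOn_weightedLoss hℓ hw
  have hFΘ : ∀ D, ConvexOn ℝ Θ (weightedLoss ℓ w D) := fun D =>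
    (hF D).subset (Set.subset_univ _) hΘ
  have hF2 : ∀ D, ContDiff ℝ 2 (weightedLoss ℓ w D) := contDiff_weightedLoss hℓ'
  have hFd : ∀ D, Differentiable ℝ (weightedLoss ℓ w D) := fun D =>
    (hF2 D).differentiable two_ne_zero
  -- The data-free reference minimizer, through which both datasets are compared.
  choose m hmem hmin using fun u =>
    (existsUnique_isMinOn_add_sq_add_inner hΘc hΘ hne hh hg u).exists
  have hm : IsRegularizedMinimizer Θ (fun θ => n * R θ) (n * γ) m := ⟨hmem, hmin⟩
  have hM : ∀ D, IsRegularizedMinimizer Θ (fun θ => n * R θ + weightedLoss ℓ w D θ) (n * γ)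
      (privEstimator Θ ℓ R w γ D) := by
    intro D
    have h := fun b => argminOn_spec
      (existsUnique_isMinOn_privObjective hn hΘc hΘ hne hℓ hR hw hγ D b).exists
    exact ⟨fun b => (h b).1, fun b => (isMinOn_privObjective_iff hn).1 (h b).2⟩
  have hmL := hm.lipschitzWith hhΘ hg
  have hML := fun D => (hM D).lipschitzWith (hhΘ.add (hFΘ D)) hg
  have hMV := fun D => hm.apply_sub_gradient (hM D) hhΘ hg (hFΘ D) (hFd D)
  have hmV := fun D => hm.apply_add_gradient (hM D) hhΘ hg (hFΘ D) (hFd D)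
  set V : (Fin n → X) → Param p → Param p :=
    fun D u => u - gradient (weightedLoss ℓ w D) (m u) with hV
  have hVbij : ∀ D, Function.Bijective (V D) := by
    refine fun D => ⟨fun u v huv => ?_, fun b => ⟨b + gradient (weightedLoss ℓ w D)
      (privEstimator Θ ℓ R w γ D b), ?_⟩⟩
    · have h1 : m u = m v := by rw [← hMV D u, ← hMV D v]; exact congrArg _ huv
      simpa [hV, h1] using huv
    · simp [hV, hmV D b]
  have hVL : ∀ D, LocallyLipschitz (V D) := fun D =>
    LocallyLipschitz.id.sub ((contDiff_gradient (hF2 D)).locallyLipschitz.comp hmL.locallyLipschitz)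
  -- The exceptional set comes from `m` alone, so one null set serves both datasets.
  have hVd : ∀ D, ∀ u ∈ {u | DifferentiableAt ℝ m u}, HasFDerivAt (V D)
      (1 + (fderiv ℝ (gradient (weightedLoss ℓ w D)) (m u)) * (-fderiv ℝ m u)) u := by
    intro D u hu
    have hu : DifferentiableAt ℝ m u := hu
    have h1 := ((contDiff_gradient (hF2 D)).differentiable one_ne_zero (m u)).hasFDerivAt.comp u
      hu.hasFDerivAt
    refine ((hasFDerivAt_id u).sub h1).congr_fderiv ?_
    ext1 v
    simp [sub_eq_add_neg]
  have hdet : ∀ D, ∀ u ∈ {u | DifferentiableAt ℝ m u},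
      1 ≤ (1 + (fderiv ℝ (gradient (weightedLoss ℓ w D)) (m u)) * (-fderiv ℝ m u)).det ∧
      (1 + (fderiv ℝ (gradient (weightedLoss ℓ w D)) (m u)) * (-fderiv ℝ m u)).det ≤
        Real.exp (lam / γ) := by
    intro D u hu
    have hu : HasFDerivAt m (fderiv ℝ m u) u := DifferentiableAt.hasFDerivAt hu
    have h1 := linearMap_det_one_add_comp_bounds (isPositive_fderiv_gradient (hF2 D) (hF D) (m u))
      (hm.isPositive_neg_fderiv hhΘ hg hu) (hm.inner_neg_fderiv_le hhΘ hg hu)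
    refine ⟨h1.1, h1.2.trans (Real.exp_le_exp.2 ?_)⟩
    have h2 := trace_fderiv_gradient_weightedLoss_le hℓ' hw (fun d => hlam d _ (hmem u)) D
    refine (mul_le_mul_of_nonneg_left h2 (inv_nonneg.2 hg.le)).trans_eq ?_
    field_simp
  have hN0 : (volume : Measure (Param p)) {u | DifferentiableAt ℝ m u}ᶜ = 0 :=
    ae_iff.1 hmL.ae_differentiableAt
  refine withDensity_preimage_le_of_reparametrization volume hmL.continuous.measurable
    (hML D).continuous.measurable (hML D').continuous.measurable (hVbij D) (hVbij D') (hVL D)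
    (hVL D') (hMV D) (hMV D') (measurableSet_of_differentiableAt ℝ m) hN0 (hVd D) (hVd D') hG
    ENNReal.ofReal_ne_top (fun u hu huG => ?_) hS
  have hdist : ‖V D' u - V D u‖ ≤ 2 * n * ζ := by
    have h1 := norm_gradient_weightedLoss_le hℓ' hw (fun d => hζ d _ (hmem u)) D
    have h2 := norm_gradient_weightedLoss_le hℓ' hw (fun d => hζ d _ (hmem u)) D'
    simp only [hV, sub_sub_sub_cancel_left]
    exact (norm_sub_le _ _).trans (by linarith)
  have hd1 := hdet D u hu
  have hd2 := hdet D' u hu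
  rw [abs_of_nonneg (zero_le_one.trans hd1.1), abs_of_nonneg (zero_le_one.trans hd2.1)]
  calc _ ≤ ENNReal.ofReal (Real.exp (lam / γ)) * f (V D u) := by
        gcongr
        exact hd1.2
    _ ≤ ENNReal.ofReal (Real.exp ε) * f (V D' u) := hf _ _ huG hdist
    _ = ENNReal.ofReal (Real.exp ε) * (ENNReal.ofReal 1 * f (V D' u)) := by simp
    _ ≤ _ := by
        gcongr
        exact hd2.1

theorem trace_hessian_bound_nonneg (hℓ : ∀ d, ConvexOn ℝ Set.univ (ℓ d))
    (hℓ' : ∀ d, ContDiff ℝ 2 (ℓ d)) (hne : Θ.Nonempty) {lam : ℝ}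
    (hlam : ∀ d, ∀ θ ∈ Θ, (hessian (ℓ d) θ).trace ≤ lam) (d : X) : 0 ≤ lam := by
  obtain ⟨θ, hθ⟩ := hne
  refine le_trans ?_ (hlam d θ hθ)
  rw [← trace_fderiv_gradient (hℓ' d)]
  exact (isPositive_fderiv_gradient (hℓ' d) (hℓ d) θ).trace_nonneg

end WeightedLoss

/-! ### Numerical inequalities for the constants -/

theorem six_mul_le_sqrt_six_mul_rpow (n : ℕ) :
    6 * (n : ℝ) ≤ √6 * ((n : ℝ) + 1) ^ (3 / 2 : ℝ) := by
  have h0 : (0 : ℝ) ≤ n := n.cast_nonneg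
  have h1 : (((n : ℝ) + 1) ^ (3 / 2 : ℝ)) ^ 2 = ((n : ℝ) + 1) ^ 3 := by
    rw [← Real.rpow_natCast, ← Real.rpow_mul (by positivity), ← Real.rpow_natCast]
    norm_num
  refine le_of_sq_le_sq ?_ (by positivity)
  rw [mul_pow, mul_pow, Real.sq_sqrt (by norm_num), h1]
  rcases n.eq_zero_or_pos with rfl | hn
  · norm_num
  · have : (1 : ℝ) ≤ n := by exact_mod_cast hn
    -- After squaring, the claim is `6 n² ≤ (n + 1)³`, and `(n + 1)³ - 6 n² = (n - 1)³ + 2`.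
    have := pow_nonneg (sub_nonneg.2 this) 3
    nlinarith

theorem div_le_of_regularization_ge {n : ℕ} (hn : 0 < n) {lam ε γ : ℝ} (hlam : 0 ≤ lam)
    (hε : 0 < ε) (hγ : 0 < γ)
    (h : γ ≥ 2 * lam / (ε * (n : ℝ)) * (√6 * ((n : ℝ) + 1) ^ (3 / 2 : ℝ))) :
    lam / γ ≤ ε / 12 := by
  have hn' : (0 : ℝ) < n := by exact_mod_cast hn
  have h1 := (mul_le_mul_of_nonneg_left (six_mul_le_sqrt_six_mul_rpow n)
    (by positivity : 0 ≤ 2 * lam / (ε * (n : ℝ)))).trans h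
  have h2 : 2 * lam / (ε * (n : ℝ)) * (6 * n) = 12 * lam / ε := by
    field_simp
    ring
  rw [h2, div_le_iff₀ hε] at h1
  rw [div_le_iff₀ hγ]
  linarith

/-- The exponent of the ratio of Gaussian densities on the good set. -/
theorem gaussian_exponent_le {σ L a ε s : ℝ} (hσ : 0 < σ) (hL : 0 ≤ L) (ha : 0 ≤ a)
    (hε : 0 < ε) (hs : L ≤ s) (hεL : ε ≤ 10 * L ^ 2) (h : a / ε * (L + s) * 3 ≤ σ)
    {x y : ℝ} (hx : x ≤ σ * L) (hy0 : 0 ≤ y) (hy : y ≤ x + 2 * a) :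
    ε / 12 + -(1 / (2 * σ ^ 2)) * x ^ 2 ≤ ε + -(1 / (2 * σ ^ 2)) * y ^ 2 := by
  have h1 : 6 * a * L ≤ σ * ε := by
    have h2 : a * (L + s) * 3 ≤ σ * ε := by
      have := mul_le_mul_of_nonneg_right h hε.le
      have e : a / ε * (L + s) * 3 * ε = a * (L + s) * 3 := by field_simp
      linarith
    nlinarith
  -- The budget restriction `ε ≤ 10 L²` controls the quadratic term `4 a²`, which `h1` alone does
  -- not.
  have h3 : 36 * a ^ 2 * ε ≤ 10 * σ ^ 2 * ε * ε := by
    have := pow_le_pow_left₀ (by positivity) h1 2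
    nlinarith [mul_le_mul_of_nonneg_left hεL (by positivity : 0 ≤ 36 * a ^ 2)]
  have h4 : 36 * a ^ 2 ≤ 10 * σ ^ 2 * ε := le_of_mul_le_mul_right h3 hε
  have h5 : y ^ 2 ≤ x ^ 2 + 4 * (a * (σ * L)) + 4 * a ^ 2 := by
    have := pow_le_pow_left₀ hy0 hy 2
    nlinarith [mul_le_mul_of_nonneg_left hx ha]
  have h6 : 6 * (a * (σ * L)) ≤ σ ^ 2 * ε := by nlinarith
  -- `h6` and `h4` bound the quotient by `(2/3 + 10/9) ε / 2 = 8 ε / 9`, which fits beside the `ε /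
  -- 12` of the Jacobian.
  have h7 : (y ^ 2 - x ^ 2) / (2 * σ ^ 2) ≤ 11 / 12 * ε := by
    rw [div_le_iff₀ (by positivity)]
    nlinarith [mul_pos (pow_pos hσ 2) hε]
  have h8 : (y ^ 2 - x ^ 2) / (2 * σ ^ 2) =
      1 / (2 * σ ^ 2) * y ^ 2 - 1 / (2 * σ ^ 2) * x ^ 2 := by ring
  linarith

end DPTwoStageERM

/-! ### The corollary for Gamma and Gaussian noise -/

theorem mainTheorem6 {p n : ℕ} (hn : 0 < n) {X : Type*}
    (Θ : Set (DPTwoStageERM.Param p))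
    (hΘ_closed : IsClosed Θ) (hΘ_convex : Convex ℝ Θ) (hΘ_nonempty : Θ.Nonempty)
    (ℓ : X → DPTwoStageERM.Param p → ℝ)
    (hℓ_convex : ∀ d, ConvexOn ℝ Set.univ (ℓ d)) (hℓ_smooth : ∀ d, ContDiff ℝ 2 (ℓ d))
    (R : DPTwoStageERM.Param p → ℝ) (hR_convex : ConvexOn ℝ Set.univ R)
    (lam ζ : ℝ)
    (hlam : ∀ d, ∀ θ ∈ Θ, (DPTwoStageERM.hessian (ℓ d) θ).trace ≤ lam)
    (hζ : ∀ d, ∀ θ ∈ Θ, ‖gradient (ℓ d) θ‖ ≤ ζ)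
    (w : (Fin n → X) → Fin n → ℝ) (hw : ∀ D, w D ∈ DPTwoStageERM.weightSimplex n)
    (ε γ : ℝ) (hε : 0 < ε) (hγ_pos : 0 < γ)
    (hγ : γ ≥ 2 * lam / (ε * (n : ℝ)) * (√6 * ((n : ℝ) + 1) ^ (3 / 2 : ℝ))) :
    (∀ (D : Fin n → X) (b : DPTwoStageERM.Param p),
      ∃! θ, θ ∈ Θ ∧ IsMinOn (DPTwoStageERM.privObjective ℓ R w γ D b) Θ θ) ∧
    (∀ β : ℝ, 0 < β → 1 / β ≥ 2 * ζ / ε * (3 * (n : ℝ)) →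
      DPTwoStageERM.IsDifferentiallyPrivate (DPTwoStageERM.gammaNoise p β)
        (DPTwoStageERM.privEstimator Θ ℓ R w γ) ε 0) ∧
    (∀ δ σ : ℝ, 0 < δ → δ ≤ 1 → 0 < σ →
      ε ≤ 10 * DPTwoStageERM.tailRadius p δ ^ 2 →
      σ ≥ ζ / ε *
        (DPTwoStageERM.tailRadius p δ +
          √(DPTwoStageERM.tailRadius p δ ^ 2 + ε / (3 * (n : ℝ)))) * (3 * (n : ℝ)) →
      DPTwoStageERM.IsDifferentiallyPrivate (DPTwoStageERM.gaussianNoise p σ)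
        (DPTwoStageERM.privEstimator Θ ℓ R w γ) ε δ) := by
  have hn' : (0 : ℝ) < n := by exact_mod_cast hn
  -- A dataset is taken as argument because `X` may be empty, and the sign of `lam` is known only
  -- once some data point exists.
  have hlamγ : ∀ _ : Fin n → X, lam / γ ≤ ε / 12 := fun D =>
    DPTwoStageERM.div_le_of_regularization_ge hn
      (DPTwoStageERM.trace_hessian_bound_nonneg hℓ_convex hℓ_smooth hΘ_nonempty hlam (D ⟨0, hn⟩))
      hε hγ_pos hγ
  have hζ0 : ∀ _ : Fin n → X, 0 ≤ ζ := fun D => by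
    obtain ⟨θ, hθ⟩ := hΘ_nonempty
    exact (norm_nonneg _).trans (hζ (D ⟨0, hn⟩) θ hθ)
  have key := fun {f : DPTwoStageERM.Param p → ENNReal} {G : Set (DPTwoStageERM.Param p)}
    (hG : MeasurableSet G) => DPTwoStageERM.withDensity_privEstimator_le (f := f) (ε := ε) hn
      hΘ_closed hΘ_convex hΘ_nonempty hℓ_convex hℓ_smooth hR_convex hw hγ_pos hlam hζ hG
  refine ⟨DPTwoStageERM.existsUnique_isMinOn_privObjective hn hΘ_closed hΘ_convex hΘ_nonempty
    hℓ_convex hR_convex hw hγ_pos, fun β hβ hβζ D D' _ S hS => ?_,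
    fun δ σ hδ hδ1 hσ hεL hσζ D D' _ S hS => ?_⟩
  · have h1 : β * (2 * n * ζ) ≤ ε / 3 := by
      rw [ge_iff_le, le_div_iff₀ hβ] at hβζ
      have e : 2 * ζ / ε * (3 * (n : ℝ)) * β = β * (2 * n * ζ) * 3 / ε := by ring
      rw [e, div_le_one hε] at hβζ
      linarith
    have h2 := key (f := fun x => ENNReal.ofReal (Real.exp (-β * ‖x‖))) MeasurableSet.univ
      (fun b b' _ hbb' => ?_) D D' hS
    · rw [Set.inter_univ] at h2
      -- The normalizing constant multiplies both sides, so its value is not needed.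
      rw [ENNReal.ofReal_zero, add_zero, DPTwoStageERM.gammaNoise, Measure.smul_apply,
        Measure.smul_apply, smul_eq_mul, smul_eq_mul, mul_left_comm]
      exact mul_le_mul_right h2 _
    · rw [← ENNReal.ofReal_mul (Real.exp_pos _).le, ← ENNReal.ofReal_mul (Real.exp_pos _).le,
        ← Real.exp_add, ← Real.exp_add]
      refine ENNReal.ofReal_le_ofReal (Real.exp_le_exp.2 ?_)
      have h3 := norm_sub_norm_le b' b
      have h4 := mul_le_mul_of_nonneg_left (h3.trans hbb') hβ.le
      have h5 := hlamγ D
      nlinarith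
  · set L := DPTwoStageERM.tailRadius p δ with hL
    have hL0 : 0 ≤ L := Real.sqrt_nonneg _
    have hGm : MeasurableSet {x : DPTwoStageERM.Param p | ‖x‖ ≤ σ * L} :=
      measurableSet_le measurable_norm measurable_const
    have h2 := key (f := fun x => ENNReal.ofReal (Real.exp (-(1 / (2 * σ ^ 2)) * ‖x‖ ^ 2))) hGm
      (fun b b' hb hbb' => ?_) D D' hS
    · have h3 : {ω | DPTwoStageERM.privEstimator Θ ℓ R w γ D ω ∈ S} ⊆
          (DPTwoStageERM.privEstimator Θ ℓ R w γ D ⁻¹' S ∩ {x | ‖x‖ ≤ σ * L}) ∪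
            {x | σ * L < ‖x‖} := by
        intro x hx
        rcases le_or_gt ‖x‖ (σ * L) with h | h
        · exact Or.inl ⟨hx, h⟩
        · exact Or.inr h
      refine (measure_mono h3).trans ((measure_union_le _ _).trans (add_le_add ?_
        (DPTwoStageERM.gaussianNoise_norm_gt_tailRadius_le p hσ hδ hδ1)))
      rw [DPTwoStageERM.gaussianNoise_eq_smul_gaussianWeight p hσ, Measure.smul_apply,
        Measure.smul_apply, smul_eq_mul, smul_eq_mul, mul_left_comm]
      exact mul_le_mul_right h2 _
    · rw [← ENNReal.ofReal_mul (Real.exp_pos _).le, ← ENNReal.ofReal_mul (Real.exp_pos _).le,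
        ← Real.exp_add, ← Real.exp_add]
      refine ENNReal.ofReal_le_ofReal (Real.exp_le_exp.2 ?_)
      have h3 := norm_sub_norm_le b' b
      have h5 := hlamγ D
      have hs : L ≤ √(L ^ 2 + ε / (3 * (n : ℝ))) :=
        Real.le_sqrt_of_sq_le (le_add_of_nonneg_right (by positivity))
      -- Applied with `a = n ζ`, half the largest distance between the two noise vectors.
      have h6 := DPTwoStageERM.gaussian_exponent_le hσ hL0
        (mul_nonneg hn'.le (hζ0 D)) hε hs hεL (le_of_eq_of_le (by ring) hσζ)
        hb (norm_nonneg b') (by linarith)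
      linarith
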